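/- Let $n\ge 1$ and let $a_{ij}:[0,\infty)\to[0,\infty)$, $i,j\in\{1,\dots,n\}$, be measurable functions that are cut-balanced: there is a constant $K\ge 1$ such that for all $t\ge 0$ and all nonempty proper subsets $S$ of $\{1,\dots,n\}$, $$K^{-1}\sum_{i\in S,\,j\notin S}a_{ji}(t)\;\le\;\sum_{i\in S,\,j\notin S}a_{ij}(t)\;\le\;K\sum_{i\in S,\,j\notin S}a_{ji}(t).$$ Let $G$ be the directed graph on $\{1,\dots,n\}$ in which $(j,i)$ is an edge if and only if $\int_0^\infty a_{ij}(t)\,dt=\infty$. A solution is a function $x:[0,\infty)\to\mathbb{R}^n$ such that, for all $i$ and all $t\ge 0$, the function $\sum_j a_{ij}(x_j-x_i)$ is Lebesgue integrable on $[0,t]$ and $$x_i(t)=x_i(0)+\int_0^t\sum_{j=1}^n a_{ij}(\tau)\bigl(x_j(\tau)-x_i(\tau)\bigr)\,d\tau .$$ (a) For every solution $x$ and every $i$, the limit $x_i^*=\lim_{t\to\infty}x_i(t)$ exists, and $x_i^*\in[\min_j x_j(0),\max_j x_j(0)]$. (b) Every weakly connected component of $G$ is strongly connected. If, in addition, $\int_0^T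 a_{ij}(t)\,dt<\infty$ for all $i,j$ and all $T<\infty$, then: (c) For every solution $x$ and all $i,j$, $\int_0^\infty a_{ij}(t)\,|x_j(t)-x_i(t)|\,dt<\infty$; and if $i$ and $j$ belong to the same (weakly) connected component of $G$, then $x_i^*=x_j^*$. (d) For all $i,j$ that belong to different connected components of $G$ there is an $(n-1)$-dimensional linear subspace $V_{ij}$ of $\mathbb{R}^n$, which depends only on $i$, $j$ and the functions $a_{kl}$, such that $x_i^*\ne x_j^*$ for every solution $x$ with $x(0)\notin V_{ij}$. -/

import Mathlib

open Set Filter Topology MeasureTheory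

noncomputable section

namespace Consensus

/-- Interaction coefficients `a i j t`, used only at times `t ≥ 0`: nonnegative and
(Lebesgue) measurable on `[0, ∞)`. -/
structure IsCoefficients {n : ℕ} (a : Fin n → Fin n → ℝ → ℝ) : Prop where
  nonneg : ∀ i j t, 0 ≤ t → 0 ≤ a i j t
  aemeasurable : ∀ i j, AEMeasurable (a i j) (volume.restrict (Ici 0))

/-- Cut-balance, with one constant `K ≥ 1` for all times and all nonempty proper subsets. -/
def CutBalanced {n : ℕ} (a : Fin n → Fin n → ℝ → ℝ) : Prop :=
  ∃ K : ℝ, 1 ≤ K ∧ ∀ t : ℝ, 0 ≤ t → ∀ S : Finset (Fin n), S.Nonempty → S ≠ Finset.univ →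
    K⁻¹ * ∑ i ∈ S, ∑ j ∈ Sᶜ, a j i t ≤ ∑ i ∈ S, ∑ j ∈ Sᶜ, a i j t ∧
      ∑ i ∈ S, ∑ j ∈ Sᶜ, a i j t ≤ K * ∑ i ∈ S, ∑ j ∈ Sᶜ, a j i t

/-- Boundedness: `∫₀ᵀ a i j < ∞` for every finite `T`. -/
def LocallyBounded {n : ℕ} (a : Fin n → Fin n → ℝ → ℝ) : Prop :=
  ∀ i j, ∀ T : ℝ, ∫⁻ t in Icc 0 T, ENNReal.ofReal (a i j t) < ⊤

/-- `x : [0, ∞) → ℝⁿ` (only the values at times `t ≥ 0` matter) solves the system of integral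
equations `x_i(t) = x_i(0) + ∫₀ᵗ ∑_j a_ij (x_j - x_i)`; the integrability clause says that the
integrals on the right-hand side exist as Lebesgue integrals. -/
def IsSolution {n : ℕ} (a : Fin n → Fin n → ℝ → ℝ) (x : ℝ → Fin n → ℝ) : Prop :=
  ∀ i, ∀ t : ℝ, 0 ≤ t →
    IntervalIntegrable (fun τ => ∑ j, a i j τ * (x τ j - x τ i)) volume 0 t ∧
      x t i = x 0 i + ∫ τ in (0 : ℝ)..t, ∑ j, a i j τ * (x τ j - x τ i)

/-- The unbounded interactions graph: `(j, i)` is an edge iff `∫₀^∞ a i j = ∞`. -/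
def unboundedGraph {n : ℕ} (a : Fin n → Fin n → ℝ → ℝ) : Digraph (Fin n) where
  Adj j i := ∫⁻ t in Ici 0, ENNReal.ofReal (a i j t) = ⊤

/-- The weakly connected components of a directed graph: the connected components of the
undirected graph in which the orientation of the edges is forgotten. -/
abbrev WeakComponent {V : Type*} (G : Digraph V) : Type _ :=
  G.toSimpleGraphInclusive.ConnectedComponent

/-- The weakly connected component of a vertex. -/
abbrev weakComponent {V : Type*} (G : Digraph V) (v : V) : WeakComponent G :=
  G.toSimpleGraphInclusive.connectedComponentMk v

/-- The subgraph of `G` induced on the vertex set `s` is strongly connected: any vertex of `s` can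
be reached from any other one by a directed path of `G` inside `s`. -/
def StronglyConnectedOn {V : Type*} (G : Digraph V) (s : Set V) : Prop :=
  ∀ u v : s, Relation.ReflTransGen (fun p q : s => G.Adj p q) u v

end Consensus

end

/-!
The state `x` is driven towards agreement in such a way that a sum of its coordinates, taken in
increasing order with the weights `(2K)^(n-1), …, 2K, 1`, grows at least as fast as a constant times
the total interaction `∑ a i j * |x j - x i|`. Up to the rearrangement inequality this sum is a
minimum of finitely many absolutely continuous functions, so it may be differentiated almost
everywhere although the order changes with time. The growth estimate is linear over the superlevel
sets of `x` (layer cake), and for a single cut it holds because the smallest weight below the cut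
is at least `2K` times the largest weight above it, which beats the factor `K` of cut-balance. As
the sum is bounded, the total interaction is integrable, and the solution converges.

For agents in different components, the initial states of the solutions with `x i - x j → 0` form a
subspace, and it is enough that it is proper. Solutions are unique backwards in time, so it may be
tested by the states at any later time `T`. Interactions between components are integrable, so
after a late `T` they cannot bring together two groups that are at `0` and `1` at time `T`.
-/

namespace Consensus

section Envelope

lemma absolutelyContinuousOnInterval_congr {F G : ℝ → ℝ} {s t : ℝ}
    (hF : AbsolutelyContinuousOnInterval F s t) (hFG : EqOn F G (uIcc s t)) :
    AbsolutelyContinuousOnInterval G s t := by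
  refine Tendsto.congr' ?_ hF
  filter_upwards [mem_inf_of_right (mem_principal_self _)] with E hE
  exact Finset.sum_congr rfl fun k hk => by rw [hFG (hE.1 k hk).1, hFG (hE.1 k hk).2]

lemma absolutelyContinuousOnInterval_sum {κ : Type*} {f : κ → ℝ → ℝ} {s t : ℝ} (S : Finset κ)
    (hf : ∀ k ∈ S, AbsolutelyContinuousOnInterval (f k) s t) :
    AbsolutelyContinuousOnInterval (fun u => ∑ k ∈ S, f k u) s t := by
  rw [← Finset.sum_fn]
  exact Finset.sum_induction _ (AbsolutelyContinuousOnInterval · s t) (fun _ _ => .add)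
    (by simpa [AbsolutelyContinuousOnInterval] using tendsto_const_nhds) hf

lemma deriv_eq_of_le_of_eq {F f : ℝ → ℝ} {u : ℝ} (hF : DifferentiableAt ℝ F u)
    (hf : DifferentiableAt ℝ f u) (hle : ∀ᶠ v in 𝓝 u, F v ≤ f v) (heq : F u = f u) :
    deriv F u = deriv f u := by
  have hmax : IsLocalMax (F - f) u := by
    filter_upwards [hle] with v hv
    simpa [heq] using hv
  rw [← sub_eq_zero, ← deriv_sub hF hf, hmax.deriv_eq_zero]

lemma dist_iInf_le_sum_dist {ι : Type*} [Fintype ι] [Nonempty ι] (p q : ι → ℝ) :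
    dist (⨅ i, p i) (⨅ i, q i) ≤ ∑ i, dist (p i) (q i) := by
  have sub_le : ∀ p q : ι → ℝ, (⨅ i, p i) - ⨅ i, q i ≤ ∑ i, dist (p i) (q i) := by
    intro p q
    obtain ⟨i, hi⟩ := exists_eq_ciInf_of_finite (f := q)
    calc (⨅ i, p i) - ⨅ i, q i ≤ p i - q i :=
          sub_le_sub (ciInf_le (finite_range p).bddBelow i) hi.le
      _ ≤ dist (p i) (q i) := le_abs_self _
      _ ≤ ∑ i, dist (p i) (q i) :=
          Finset.single_le_sum (f := fun i => dist (p i) (q i)) (fun _ _ => dist_nonneg)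
            (Finset.mem_univ i)
  refine abs_sub_le_iff.2 ⟨sub_le p q, ?_⟩
  simpa only [dist_comm] using sub_le q p

variable {ι : Type*} [Finite ι] [Nonempty ι] {f : ι → ℝ → ℝ} {h : ℝ → ℝ} {s t : ℝ}

lemma absolutelyContinuousOnInterval_iInf (hf : ∀ i, AbsolutelyContinuousOnInterval (f i) s t) :
    AbsolutelyContinuousOnInterval (fun u => ⨅ i, f i u) s t := by
  have := Fintype.ofFinite ι
  refine squeeze_zero (fun E => Finset.sum_nonneg fun _ _ => dist_nonneg) (fun E => ?_)
    (by simpa using tendsto_finsetSum Finset.univ fun i _ => hf i)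
  rw [Finset.sum_comm]
  exact Finset.sum_le_sum fun k _ => dist_iInf_le_sum_dist _ _

lemma ae_le_deriv_iInf (hst : s ≤ t) (hf : ∀ i, AbsolutelyContinuousOnInterval (f i) s t)
    (hact : ∀ᵐ u ∂volume.restrict (Icc s t),
      ∃ i, f i u = ⨅ j, f j u ∧ h u ≤ deriv (f i) u) :
    ∀ᵐ u ∂volume.restrict (Icc s t), h u ≤ deriv (fun v => ⨅ i, f i v) u := by
  have hdiff : ∀ᵐ u, ∀ i, u ∈ uIcc s t → DifferentiableAt ℝ (f i) u :=
    ae_all_iff.2 fun i => (hf i).ae_differentiableAt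
  filter_upwards [hact, ae_restrict_mem measurableSet_Icc, ae_restrict_of_ae hdiff,
    ae_restrict_of_ae (absolutelyContinuousOnInterval_iInf hf).ae_differentiableAt]
    with u ⟨i, hi, hhi⟩ hu hfu hFu
  rw [uIcc_of_le hst] at hfu hFu
  rwa [deriv_eq_of_le_of_eq (hFu hu) (hfu i hu)
    (Eventually.of_forall fun v => ciInf_le (finite_range _).bddBelow i) hi.symm]

lemma integral_le_iInf_sub_iInf (hst : s ≤ t)
    (hf : ∀ i, AbsolutelyContinuousOnInterval (f i) s t) (hh : IntervalIntegrable h volume s t)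
    (hact : ∀ᵐ u ∂volume.restrict (Icc s t),
      ∃ i, f i u = ⨅ j, f j u ∧ h u ≤ deriv (f i) u) :
    ∫ u in s..t, h u ≤ (⨅ i, f i t) - ⨅ i, f i s := by
  have hF := absolutelyContinuousOnInterval_iInf hf
  rw [← hF.integral_deriv_eq_sub]
  exact intervalIntegral.integral_mono_ae_restrict hst hh hF.intervalIntegrable_deriv
    (ae_le_deriv_iInf hst hf hact)

lemma integrableOn_Ici_of_iInf_le {B : ℝ}
    (hf : ∀ t, s ≤ t → ∀ i, AbsolutelyContinuousOnInterval (f i) s t)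
    (hB : ∀ t, s ≤ t → ⨅ i, f i t ≤ B) (hm : AEMeasurable h (volume.restrict (Ici s)))
    (h_nonneg : ∀ t, s ≤ t → 0 ≤ h t)
    (hact : ∀ᵐ u ∂volume.restrict (Ici s), ∃ i, f i u = ⨅ j, f j u ∧ h u ≤ deriv (f i) u) :
    IntegrableOn h (Ici s) := by
  have hact' : ∀ t, ∀ᵐ u ∂volume.restrict (Icc s t),
      ∃ i, f i u = ⨅ j, f j u ∧ h u ≤ deriv (f i) u := fun t =>
    ae_mono (Measure.restrict_mono Icc_subset_Ici_self le_rfl) hact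
  have hint : ∀ t, s ≤ t → IntervalIntegrable h volume s t := by
    intro t hst
    have hderiv := (absolutelyContinuousOnInterval_iInf (hf t hst)).intervalIntegrable_deriv
    rw [intervalIntegrable_iff_integrableOn_Icc_of_le hst] at hderiv ⊢
    refine hderiv.mono' (hm.mono_set Icc_subset_Ici_self).aestronglyMeasurable ?_
    filter_upwards [ae_le_deriv_iInf hst (hf t hst) (hact' t), ae_restrict_mem measurableSet_Icc]
      with u hu hsu
    rwa [Real.norm_of_nonneg (h_nonneg u hsu.1)]
  rw [integrableOn_Ici_iff_integrableOn_Ioi]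
  refine integrableOn_Ioi_of_intervalIntegral_norm_bounded (B - ⨅ i, f i s) s
    (fun t => ?_) tendsto_id ((eventually_ge_atTop s).mono fun t hst => ?_)
  · rcases le_total s t with hst | hts
    · exact (hint t hst).1
    · simp [Ioc_eq_empty_of_le hts]
  · have hnorm : ∫ u in s..t, ‖h u‖ = ∫ u in s..t, h u :=
      intervalIntegral.integral_congr fun u hu =>
        Real.norm_of_nonneg (h_nonneg u (uIcc_of_le hst ▸ hu).1)
    rw [id, hnorm]
    exact (integral_le_iInf_sub_iInf hst (hf t hst) (hint t hst) (hact' t)).trans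
      (sub_le_sub_right (hB t hst) _)

end Envelope

section CutInequality

variable {ι : Type*}

lemma intervalIntegrable_sum {κ : Type*} {S : Finset κ} {f : κ → ℝ → ℝ} {s t : ℝ}
    (hf : ∀ k ∈ S, IntervalIntegrable (f k) volume s t) :
    IntervalIntegrable (fun u => ∑ k ∈ S, f k u) volume s t := by
  simpa only [Finset.sum_fn] using IntervalIntegrable.sum S hf

/-- The indicator of the superlevel set `{k | θ ≤ y k}`, by which the layer-cake formula reduces
an inequality for `y` to cuts. -/
noncomputable def superlevel (y : ι → ℝ) (θ : ℝ) (k : ι) : ℝ :=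
  (Iic (y k)).indicator (fun _ => 1) θ

lemma intervalIntegrable_superlevel (y : ι → ℝ) (k : ι) (s t : ℝ) :
    IntervalIntegrable (superlevel y · k) volume s t :=
  ⟨(integrableOn_const (by simp)).indicator measurableSet_Iic,
    (integrableOn_const (by simp)).indicator measurableSet_Iic⟩

lemma intervalIntegrable_superlevel_sub (y : ι → ℝ) (k l : ι) (s t : ℝ) :
    IntervalIntegrable (fun θ => superlevel y θ l - superlevel y θ k) volume s t :=
  (intervalIntegrable_superlevel y l s t).sub (intervalIntegrable_superlevel y k s t)

variable [Fintype ι]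

/-- The right-hand side of the system at an instant when the interaction coefficients are `b`
and the state is `y`. -/
noncomputable def drift (b : ι → ι → ℝ) (y : ι → ℝ) (i : ι) : ℝ :=
  ∑ j, b i j * (y j - y i)

/-- The total interaction at an instant when the coefficients are `b` and the state is `y`: the
quantity whose integral over time the Lyapunov function controls. -/
noncomputable def interaction (b : ι → ι → ℝ) (y : ι → ℝ) : ℝ :=
  ∑ i, ∑ j, b i j * |y j - y i|

/-- Cut-balance at one instant. One inequality is enough, because the other one is this one for
the complement of `S`; both sides vanish for `S = ∅` and for `S = univ`. -/
def IsCutBounded [DecidableEq ι] (K : ℝ) (b : ι → ι → ℝ) : Prop :=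
  ∀ S : Finset ι, ∑ i ∈ Sᶜ, ∑ j ∈ S, b i j ≤ K * ∑ i ∈ S, ∑ j ∈ Sᶜ, b i j

lemma drift_add (b : ι → ι → ℝ) (y z : ι → ℝ) (i : ι) :
    drift b (y + z) i = drift b y i + drift b z i := by
  simp only [drift, Pi.add_apply, ← Finset.sum_add_distrib]
  exact Finset.sum_congr rfl fun j _ => by ring

lemma drift_smul (b : ι → ι → ℝ) (r : ℝ) (y : ι → ℝ) (i : ι) :
    drift b (r • y) i = r * drift b y i := by
  simp only [drift, Pi.smul_apply, smul_eq_mul, Finset.mul_sum]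
  exact Finset.sum_congr rfl fun j _ => by ring

lemma drift_nonneg_of_forall_le {b : ι → ι → ℝ} (hb : ∀ i j, 0 ≤ b i j) {z : ι → ℝ} {k : ι}
    (hk : ∀ l, z k ≤ z l) : 0 ≤ drift b z k :=
  Finset.sum_nonneg fun l _ => mul_nonneg (hb k l) (sub_nonneg.2 (hk l))

lemma abs_drift_le {b : ι → ι → ℝ} (hb : ∀ i j, 0 ≤ b i j) (y : ι → ℝ) (i : ι) :
    |drift b y i| ≤ (∑ k, ∑ l, b k l) * (2 * ‖y‖) :=
  calc |drift b y i| ≤ ∑ l, |b i l * (y l - y i)| := Finset.abs_sum_le_sum_abs _ _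
    _ ≤ ∑ l, b i l * (2 * ‖y‖) := Finset.sum_le_sum fun l _ => by
        rw [abs_mul, abs_of_nonneg (hb i l), two_mul]
        exact mul_le_mul_of_nonneg_left ((abs_sub _ _).trans
          (add_le_add (norm_le_pi_norm y l) (norm_le_pi_norm y i))) (hb i l)
    _ = (∑ l, b i l) * (2 * ‖y‖) := (Finset.sum_mul ..).symm
    _ ≤ (∑ k, ∑ l, b k l) * (2 * ‖y‖) := mul_le_mul_of_nonneg_right
        (Finset.single_le_sum (f := fun k => ∑ l, b k l)
          (fun k _ => Finset.sum_nonneg fun l _ => hb k l) (Finset.mem_univ i)) (by positivity)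

lemma neg_sum_compl_le_drift [DecidableEq ι] {b : ι → ι → ℝ} (hb : ∀ i j, 0 ≤ b i j)
    {z : ι → ℝ} {C : Finset ι} {k : ι} (hmin : ∀ l ∈ C, z k ≤ z l) (hz : ∀ l, z k - 1 ≤ z l) :
    -∑ l ∈ Cᶜ, b k l ≤ drift b z k := by
  rw [drift, ← Finset.sum_add_sum_compl C, ← Finset.sum_neg_distrib]
  refine le_add_of_nonneg_of_le
    (Finset.sum_nonneg fun l hl => mul_nonneg (hb k l) (sub_nonneg.2 (hmin l hl)))
    (Finset.sum_le_sum fun l _ => ?_)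
  nlinarith [hb k l, hz l]

lemma interaction_nonneg {b : ι → ι → ℝ} (hb : ∀ i j, 0 ≤ b i j) (y : ι → ℝ) :
    0 ≤ interaction b y :=
  Finset.sum_nonneg fun i _ => Finset.sum_nonneg fun j _ => mul_nonneg (hb i j) (abs_nonneg _)

lemma mul_abs_sub_le_interaction {b : ι → ι → ℝ} (hb : ∀ i j, 0 ≤ b i j) (y : ι → ℝ) (i j : ι) :
    b i j * |y j - y i| ≤ interaction b y := by
  have hterm : ∀ k l, 0 ≤ b k l * |y l - y k| := fun k l => mul_nonneg (hb k l) (abs_nonneg _)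
  exact (Finset.single_le_sum (fun l _ => hterm i l) (Finset.mem_univ j)).trans
    (Finset.single_le_sum (f := fun k => ∑ l, b k l * |y l - y k|)
      (fun k _ => Finset.sum_nonneg fun l _ => hterm k l) (Finset.mem_univ i))

lemma sub_eq_integral_superlevel (y : ι → ℝ) (k l : ι) :
    y l - y k = ∫ θ in -‖y‖..‖y‖, (superlevel y θ l - superlevel y θ k) := by
  have hval : ∀ k, ∫ θ in -‖y‖..‖y‖, superlevel y θ k = y k - -‖y‖ := fun k =>
    (intervalIntegral.integral_indicator (abs_le.1 (norm_le_pi_norm y k))).trans (by simp)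
  rw [intervalIntegral.integral_sub (intervalIntegrable_superlevel y l _ _)
    (intervalIntegrable_superlevel y k _ _), hval, hval, sub_sub_sub_cancel_right]

lemma intervalIntegrable_drift_superlevel (b : ι → ι → ℝ) (y : ι → ℝ) (k : ι) (s t : ℝ) :
    IntervalIntegrable (fun θ => drift b (superlevel y θ) k) volume s t :=
  intervalIntegrable_sum fun l _ =>
    (intervalIntegrable_superlevel_sub y k l s t).const_mul (b k l)

lemma drift_eq_integral_superlevel (b : ι → ι → ℝ) (y : ι → ℝ) (k : ι) :
    drift b y k = ∫ θ in -‖y‖..‖y‖, drift b (superlevel y θ) k := by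
  simp only [drift]
  rw [intervalIntegral.integral_finsetSum fun l _ =>
    (intervalIntegrable_superlevel_sub y k l _ _).const_mul (b k l)]
  exact Finset.sum_congr rfl fun l _ => by
    rw [intervalIntegral.integral_const_mul, ← sub_eq_integral_superlevel]

lemma intervalIntegrable_interaction_superlevel (b : ι → ι → ℝ) (y : ι → ℝ) (s t : ℝ) :
    IntervalIntegrable (fun θ => interaction b (superlevel y θ)) volume s t :=
  intervalIntegrable_sum fun k _ => intervalIntegrable_sum fun l _ =>
    (intervalIntegrable_superlevel_sub y k l s t).abs.const_mul (b k l)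

lemma interaction_le_integral_superlevel {b : ι → ι → ℝ} (hb : ∀ i j, 0 ≤ b i j) (y : ι → ℝ) :
    interaction b y ≤ ∫ θ in -‖y‖..‖y‖, interaction b (superlevel y θ) := by
  have hint : ∀ k l, IntervalIntegrable
      (fun θ => b k l * |superlevel y θ l - superlevel y θ k|) volume (-‖y‖) ‖y‖ := fun k l =>
    (intervalIntegrable_superlevel_sub y k l _ _).abs.const_mul (b k l)
  simp only [interaction]
  rw [intervalIntegral.integral_finsetSum fun k _ => intervalIntegrable_sum fun l _ =>
    hint k l]
  refine Finset.sum_le_sum fun k _ => ?_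
  rw [intervalIntegral.integral_finsetSum fun l _ => hint k l]
  refine Finset.sum_le_sum fun l _ => ?_
  rw [intervalIntegral.integral_const_mul, sub_eq_integral_superlevel]
  exact mul_le_mul_of_nonneg_left
    (intervalIntegral.abs_integral_le_integral_abs (neg_le_self (norm_nonneg y))) (hb k l)

lemma mul_interaction_le_of_superlevel {b : ι → ι → ℝ} (hb : ∀ i j, 0 ≤ b i j) {c : ℝ}
    (hc : 0 ≤ c) {w y : ι → ℝ}
    (h : ∀ θ, c * interaction b (superlevel y θ) ≤ ∑ k, w k * drift b (superlevel y θ) k) :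
    c * interaction b y ≤ ∑ k, w k * drift b y k := by
  have hdrift : ∀ k, IntervalIntegrable (fun θ => w k * drift b (superlevel y θ) k) volume
      (-‖y‖) ‖y‖ := fun k => (intervalIntegrable_drift_superlevel b y k _ _).const_mul (w k)
  calc c * interaction b y
      ≤ c * ∫ θ in -‖y‖..‖y‖, interaction b (superlevel y θ) := by
        gcongr
        exact interaction_le_integral_superlevel hb y
    _ = ∫ θ in -‖y‖..‖y‖, c * interaction b (superlevel y θ) :=
        (intervalIntegral.integral_const_mul ..).symm
    _ ≤ ∫ θ in -‖y‖..‖y‖, ∑ k, w k * drift b (superlevel y θ) k :=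
        intervalIntegral.integral_mono (neg_le_self (norm_nonneg y))
          ((intervalIntegrable_interaction_superlevel b y _ _).const_mul c)
          (intervalIntegrable_sum fun k _ => hdrift k) h
    _ = ∑ k, w k * drift b y k := by
        simp only [intervalIntegral.integral_finsetSum fun k _ => hdrift k,
          intervalIntegral.integral_const_mul, ← drift_eq_integral_superlevel]

section Weights

variable [DecidableEq ι] {b : ι → ι → ℝ} {K c : ℝ} {w : ι → ℝ}

lemma IsCutBounded.sum_cut_le (hcut : IsCutBounded K b) (hb : ∀ i j, 0 ≤ b i j) (hK : 0 < K)
    (hc : 0 ≤ c) {S : Finset ι} (hS : ∀ k ∈ S, ∀ l ∈ Sᶜ, 2 * K * w l ≤ w k)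
    (hw : ∀ k, 2 * (1 + K) * c ≤ w k) :
    ∑ k ∈ Sᶜ, ∑ l ∈ S, b k l * (w k + c) ≤ ∑ k ∈ S, ∑ l ∈ Sᶜ, b k l * (w k - c) := by
  rcases S.eq_empty_or_nonempty with rfl | hne
  · simp
  obtain ⟨k₀, hk₀, hmin⟩ := S.exists_min_image w hne
  have hout : ∀ l ∈ Sᶜ, w l ≤ w k₀ / (2 * K) := fun l hl =>
    (le_div_iff₀' (by positivity)).2 (hS k₀ hk₀ l hl)
  have hA : 0 ≤ ∑ k ∈ S, ∑ l ∈ Sᶜ, b k l :=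
    Finset.sum_nonneg fun k _ => Finset.sum_nonneg fun l _ => hb k l
  have hw₀ : 0 ≤ w k₀ := (by positivity : 0 ≤ 2 * (1 + K) * c).trans (hw k₀)
  calc ∑ k ∈ Sᶜ, ∑ l ∈ S, b k l * (w k + c)
      ≤ ∑ k ∈ Sᶜ, ∑ l ∈ S, b k l * (w k₀ / (2 * K) + c) := by
        gcongr with k hk l
        · exact hb k l
        · exact hout k hk
    _ = (∑ k ∈ Sᶜ, ∑ l ∈ S, b k l) * (w k₀ / (2 * K) + c) := by simp only [Finset.sum_mul]
    _ ≤ (K * ∑ k ∈ S, ∑ l ∈ Sᶜ, b k l) * (w k₀ / (2 * K) + c) := by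
        gcongr
        exact hcut S
    _ = (∑ k ∈ S, ∑ l ∈ Sᶜ, b k l) * (w k₀ / 2 + K * c) := by field_simp
    _ ≤ (∑ k ∈ S, ∑ l ∈ Sᶜ, b k l) * (w k₀ - c) := by
        gcongr
        linarith [hw k₀]
    _ = ∑ k ∈ S, ∑ l ∈ Sᶜ, b k l * (w k₀ - c) := by simp only [Finset.sum_mul]
    _ ≤ ∑ k ∈ S, ∑ l ∈ Sᶜ, b k l * (w k - c) := by
        gcongr with k hk l
        · exact hb k l
        · exact hmin k hk

lemma IsCutBounded.mul_interaction_le_of_indicator (hcut : IsCutBounded K b)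
    (hb : ∀ i j, 0 ≤ b i j) (hK : 0 < K) (hc : 0 ≤ c) {S : Finset ι}
    (hS : ∀ k ∈ S, ∀ l ∈ Sᶜ, 2 * K * w l ≤ w k) (hw : ∀ k, 2 * (1 + K) * c ≤ w k) {u : ι → ℝ}
    (hu₀ : ∀ k ∈ S, u k = 0) (hu₁ : ∀ k ∈ Sᶜ, u k = 1) :
    c * interaction b u ≤ ∑ k, w k * drift b u k := by
  have hin : ∀ k ∈ S, ∑ l, b k l * (w k * (u l - u k) - c * |u l - u k|) =
      ∑ l ∈ Sᶜ, b k l * (w k - c) := by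
    intro k hk
    rw [← Finset.sum_add_sum_compl S, Finset.sum_eq_zero fun l hl => by
      simp [hu₀ k hk, hu₀ l hl], zero_add]
    exact Finset.sum_congr rfl fun l hl => by simp [hu₀ k hk, hu₁ l hl]
  have hout : ∀ k ∈ Sᶜ, ∑ l, b k l * (w k * (u l - u k) - c * |u l - u k|) =
      -∑ l ∈ S, b k l * (w k + c) := by
    intro k hk
    rw [← Finset.sum_add_sum_compl S, Finset.sum_eq_zero (s := Sᶜ) fun l hl => by
      simp [hu₁ k hk, hu₁ l hl], add_zero, ← Finset.sum_neg_distrib]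
    exact Finset.sum_congr rfl fun l hl => by
      rw [hu₁ k hk, hu₀ l hl, zero_sub, abs_neg, abs_one]
      ring
  have hsplit : ∑ k, w k * drift b u k - c * interaction b u =
      ∑ k, ∑ l, b k l * (w k * (u l - u k) - c * |u l - u k|) := by
    simp only [drift, interaction, Finset.mul_sum, ← Finset.sum_sub_distrib]
    exact Finset.sum_congr rfl fun k _ => Finset.sum_congr rfl fun l _ => by ring
  rw [← sub_nonneg, hsplit, ← Finset.sum_add_sum_compl S, Finset.sum_congr rfl hin,
    Finset.sum_congr rfl hout, Finset.sum_neg_distrib]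
  linarith [hcut.sum_cut_le hb hK hc hS hw]

lemma IsCutBounded.mul_interaction_le (hcut : IsCutBounded K b) (hb : ∀ i j, 0 ≤ b i j)
    (hK : 0 < K) (hc : 0 ≤ c) {y : ι → ℝ} (hyw : ∀ k l, y k < y l → 2 * K * w l ≤ w k)
    (hw : ∀ k, 2 * (1 + K) * c ≤ w k) :
    c * interaction b y ≤ ∑ k, w k * drift b y k := by
  refine mul_interaction_le_of_superlevel hb hc fun θ =>
    hcut.mul_interaction_le_of_indicator hb hK hc (S := Finset.univ.filter (y · < θ))
      (fun k hk l hl => hyw k l ?_) hw (fun k hk => ?_) (fun k hk => ?_)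
  · simp only [Finset.mem_filter_univ, Finset.mem_compl, not_lt] at hk hl
    exact hk.trans_le hl
  · simpa [superlevel] using hk
  · simpa [superlevel] using hk

end Weights

section LyapunovFunction

variable {n : ℕ} {b : Fin n → Fin n → ℝ} {K : ℝ}

/-- The sum of the coordinates of `y` taken in increasing order with the decreasing weights
`(2K)^(n-1), …, 2K, 1`. By the rearrangement inequality it is the least of the sums obtained from
all the orders, which is the definition used here. -/
noncomputable def lyapunov (K : ℝ) (y : Fin n → ℝ) : ℝ :=
  ⨅ σ : Equiv.Perm (Fin n), ∑ i, (2 * K) ^ (σ i : ℕ) * y i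

lemma exists_perm_antitone_rank (y : Fin n → ℝ) :
    ∃ σ : Equiv.Perm (Fin n), ∀ k l, y k < y l → σ l < σ k := by
  refine ⟨(Tuple.sort (-y)).symm, fun k l hkl => ?_⟩
  by_contra! h
  have hle : y l ≤ y k := by simpa using Tuple.monotone_sort (-y) h
  exact hle.not_gt hkl

lemma sum_pow_rank_eq_lyapunov (hK : 1 ≤ 2 * K) {y : Fin n → ℝ} {σ : Equiv.Perm (Fin n)}
    (hσ : ∀ k l, y k < y l → σ l < σ k) :
    ∑ i, (2 * K) ^ (σ i : ℕ) * y i = lyapunov K y := by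
  have hanti : Antivary (fun i => (2 * K) ^ (σ i : ℕ)) y := fun k l hkl =>
    pow_le_pow_right₀ hK (hσ k l hkl).le
  have hleast : IsLeast (range fun τ : Equiv.Perm (Fin n) => ∑ i, (2 * K) ^ (τ i : ℕ) * y i)
      (∑ i, (2 * K) ^ (σ i : ℕ) * y i) := by
    refine ⟨mem_range_self σ, ?_⟩
    rintro _ ⟨τ, rfl⟩
    simpa using hanti.sum_mul_le_sum_comp_perm_mul (σ := τ.trans σ.symm)
  exact hleast.csInf_eq.symm

lemma IsCutBounded.exists_perm_interaction_le (hcut : IsCutBounded K b)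
    (hb : ∀ i j, 0 ≤ b i j) (hK : 1 ≤ K) (y : Fin n → ℝ) :
    ∃ σ : Equiv.Perm (Fin n), ∑ i, (2 * K) ^ (σ i : ℕ) * y i = lyapunov K y ∧
      (2 * (1 + K))⁻¹ * interaction b y ≤ ∑ i, (2 * K) ^ (σ i : ℕ) * drift b y i := by
  obtain ⟨σ, hσ⟩ := exists_perm_antitone_rank y
  have hK' : 1 ≤ 2 * K := by linarith
  refine ⟨σ, sum_pow_rank_eq_lyapunov hK' hσ,
    hcut.mul_interaction_le hb (by linarith) (by positivity) (fun k l hkl => ?_) (fun k => ?_)⟩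
  · rw [← pow_succ']
    exact pow_le_pow_right₀ hK' (hσ k l hkl)
  · rw [mul_inv_cancel₀ (by positivity)]
    exact one_le_pow₀ hK'

end LyapunovFunction

end CutInequality

section Coefficients

variable {n : ℕ} {a : Fin n → Fin n → ℝ → ℝ}

lemma CutBalanced.exists_isCutBounded (hcb : CutBalanced a) :
    ∃ K, 1 ≤ K ∧ ∀ t, 0 ≤ t → IsCutBounded K (a · · t) := by
  obtain ⟨K, hK, hcut⟩ := hcb
  refine ⟨K, hK, fun t ht S => ?_⟩
  rcases Sᶜ.eq_empty_or_nonempty with hS | hS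
  · simp [hS]
  rcases eq_or_ne Sᶜ Finset.univ with hSu | hSu
  · simp [(Finset.compl_eq_univ_iff S).1 hSu]
  rw [Finset.sum_comm (s := S)]
  simpa only [compl_compl] using (hcut t ht Sᶜ hS hSu).2

end Coefficients

section Solutions

variable {n : ℕ} {a : Fin n → Fin n → ℝ → ℝ} {x y : ℝ → Fin n → ℝ} {s t : ℝ}

lemma isSolution_iff_drift : IsSolution a x ↔ ∀ i t, 0 ≤ t →
    IntervalIntegrable (fun u => drift (a · · u) (x u) i) volume 0 t ∧
      x t i = x 0 i + ∫ u in 0..t, drift (a · · u) (x u) i :=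
  Iff.rfl

lemma IsSolution.intervalIntegrable_drift (hx : IsSolution a x) (i : Fin n) (hs : 0 ≤ s)
    (ht : 0 ≤ t) : IntervalIntegrable (fun u => drift (a · · u) (x u) i) volume s t :=
  (hx i s hs).1.symm.trans (hx i t ht).1

lemma IsSolution.eq_add_integral (hx : IsSolution a x) (i : Fin n) (hs : 0 ≤ s) (ht : 0 ≤ t) :
    x t i = x s i + ∫ u in s..t, drift (a · · u) (x u) i := by
  rw [← intervalIntegral.integral_interval_sub_left (hx.intervalIntegrable_drift i le_rfl ht)
    (hx.intervalIntegrable_drift i le_rfl hs)]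
  linarith [(isSolution_iff_drift.1 hx i s hs).2, (isSolution_iff_drift.1 hx i t ht).2]

lemma isSolution_const (a : Fin n → Fin n → ℝ → ℝ) (r : ℝ) :
    IsSolution a fun _ _ => r := fun i t _ => by simp

lemma IsSolution.add (hx : IsSolution a x) (hy : IsSolution a y) : IsSolution a (x + y) := by
  refine isSolution_iff_drift.2 fun i t ht => ⟨?_, ?_⟩
  · simpa only [Pi.add_apply, drift_add] using
      (hx.intervalIntegrable_drift i le_rfl ht).add (hy.intervalIntegrable_drift i le_rfl ht)
  · simp only [Pi.add_apply, drift_add]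
    rw [intervalIntegral.integral_add (hx.intervalIntegrable_drift i le_rfl ht)
      (hy.intervalIntegrable_drift i le_rfl ht), hx.eq_add_integral i le_rfl ht,
      hy.eq_add_integral i le_rfl ht]
    ring

lemma IsSolution.const_smul (hx : IsSolution a x) (r : ℝ) : IsSolution a (r • x) := by
  refine isSolution_iff_drift.2 fun i t ht => ⟨?_, ?_⟩
  · simpa only [Pi.smul_apply, drift_smul] using
      (hx.intervalIntegrable_drift i le_rfl ht).const_mul r
  · simp only [Pi.smul_apply, drift_smul, smul_eq_mul]
    rw [intervalIntegral.integral_const_mul, hx.eq_add_integral i le_rfl ht, mul_add]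

lemma IsSolution.absolutelyContinuousOnInterval (hx : IsSolution a x) (i : Fin n) (hs : 0 ≤ s)
    (hst : s ≤ t) : AbsolutelyContinuousOnInterval (fun u => x u i) s t := by
  have hprim := (hx.intervalIntegrable_drift i hs
    (hs.trans hst)).absolutelyContinuousOnInterval_intervalIntegral left_mem_uIcc
  refine absolutelyContinuousOnInterval_congr (AbsolutelyContinuousOnInterval.add
    (f := fun _ => x s i) (by simpa [AbsolutelyContinuousOnInterval] using tendsto_const_nhds)
    hprim) fun u hu => ?_
  exact (hx.eq_add_integral i hs (hs.trans (uIcc_of_le hst ▸ hu).1)).symm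

lemma IsSolution.continuousOn (hx : IsSolution a x) (i : Fin n) :
    ContinuousOn (fun t => x t i) (Ici 0) := by
  intro t (ht : 0 ≤ t)
  have hcont := (hx.absolutelyContinuousOnInterval i le_rfl (by linarith : 0 ≤ t + 1)).continuousOn
  rw [uIcc_of_le (by linarith), ← Ici_inter_Iic] at hcont
  exact (hcont t ⟨ht, by simp⟩).mono_of_mem_nhdsWithin
    (inter_mem_nhdsWithin _ (Iic_mem_nhds (by linarith)))

lemma IsSolution.ae_hasDerivAt (hx : IsSolution a x) :
    ∀ᵐ u ∂volume.restrict (Ici 0),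
      ∀ i, HasDerivAt (fun t => x t i) (drift (a · · u) (x u) i) u := by
  have hprim : ∀ᵐ u, ∀ (i : Fin n) (N : ℕ), u ∈ uIcc (0 : ℝ) N → ∀ s ∈ uIcc (0 : ℝ) N,
      HasDerivAt (fun t => ∫ v in s..t, drift (a · · v) (x v) i) (drift (a · · u) (x u) i) u :=
    ae_all_iff.2 fun i => ae_all_iff.2 fun N =>
      (hx.intervalIntegrable_drift i le_rfl N.cast_nonneg).ae_hasDerivAt_integral
  rw [← restrict_Ioi_eq_restrict_Ici]
  filter_upwards [ae_restrict_of_ae hprim, ae_restrict_mem measurableSet_Ioi]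
    with u hu (hu₀ : 0 < u) i
  obtain ⟨N, hN⟩ := exists_nat_ge u
  have hmem : u ∈ uIcc (0 : ℝ) N := uIcc_of_le (N.cast_nonneg (α := ℝ)) ▸ ⟨hu₀.le, hN⟩
  refine ((hu i N hmem 0 left_mem_uIcc).const_add (x 0 i)).congr_of_eventuallyEq ?_
  filter_upwards [Ioi_mem_nhds hu₀] with t ht
  exact hx.eq_add_integral i le_rfl (le_of_lt ht)

lemma IsSolution.add_integral_le (hx : IsSolution a x) (hs : 0 ≤ s) (hst : s ≤ t)
    {C : Set (Fin n)} {h : ℝ → ℝ} (hh : IntervalIntegrable h volume s t) {m : ℝ}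
    (hm : ∀ k ∈ C, m ≤ x s k)
    (hC : ∀ u, s ≤ u → ∀ k ∈ C, (∀ l ∈ C, x u k ≤ x u l) → h u ≤ drift (a · · u) (x u) k)
    {k : Fin n} (hk : k ∈ C) : m + ∫ u in s..t, h u ≤ x t k := by
  have : Nonempty C := ⟨⟨k, hk⟩⟩
  have hgrowth : ∫ u in s..t, h u ≤ (⨅ l : C, x t l) - ⨅ l : C, x s l := by
    refine integral_le_iInf_sub_iInf (f := fun (l : C) u => x u l) hst
      (fun l => hx.absolutelyContinuousOnInterval l hs hst) hh ?_
    filter_upwards [ae_mono (Measure.restrict_mono (Icc_subset_Ici_iff hst |>.2 hs) le_rfl)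
      hx.ae_hasDerivAt, ae_restrict_mem measurableSet_Icc] with u hderiv hu
    obtain ⟨l, hl⟩ := exists_eq_ciInf_of_finite (f := fun l : C => x u l)
    refine ⟨l, hl, ?_⟩
    rw [(hderiv l).deriv]
    exact hC u hu.1 l l.2 fun j hj => hl.trans_le (ciInf_le (finite_range _).bddBelow (⟨j, hj⟩ : C))
  have hle : ⨅ l : C, x t l ≤ x t k := ciInf_le (finite_range _).bddBelow (⟨k, hk⟩ : C)
  have hge : m ≤ ⨅ l : C, x s l := le_ciInf fun l => hm l l.2
  linarith

lemma IsSolution.ge_of_ge (ha : IsCoefficients a) (hx : IsSolution a x) (hs : 0 ≤ s)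
    (hst : s ≤ t) {m : ℝ} (hm : ∀ k, m ≤ x s k) (k : Fin n) : m ≤ x t k := by
  simpa using hx.add_integral_le hs hst (C := univ) (h := fun _ => 0) intervalIntegrable_const
    (fun l _ => hm l) (fun u hu l _ hl => drift_nonneg_of_forall_le
      (fun i j => ha.nonneg i j u (hs.trans hu)) fun j => hl j (mem_univ j)) (mem_univ k)

lemma IsSolution.le_of_le (ha : IsCoefficients a) (hx : IsSolution a x) (hs : 0 ≤ s)
    (hst : s ≤ t) {m : ℝ} (hm : ∀ k, x s k ≤ m) (k : Fin n) : x t k ≤ m := by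
  simpa using (hx.const_smul (-1)).ge_of_ge ha hs hst (m := -m) (by simpa using hm) k

lemma IsSolution.norm_le_norm (ha : IsCoefficients a) (hx : IsSolution a x) (hs : 0 ≤ s)
    (hst : s ≤ t) : ‖x t‖ ≤ ‖x s‖ :=
  (pi_norm_le_iff_of_nonneg (norm_nonneg _)).2 fun k => abs_le.2
    ⟨hx.ge_of_ge ha hs hst (fun l => (abs_le.1 (norm_le_pi_norm (x s) l)).1) k,
      hx.le_of_le ha hs hst (fun l => (abs_le.1 (norm_le_pi_norm (x s) l)).2) k⟩

end Solutions

section Convergence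

variable {n : ℕ} {a : Fin n → Fin n → ℝ → ℝ} {x : ℝ → Fin n → ℝ}

lemma lyapunov_le_norm {K : ℝ} (hK : 0 ≤ K) (y : Fin n → ℝ) :
    lyapunov K y ≤ ∑ i : Fin n, (2 * K) ^ (i : ℕ) * ‖y‖ :=
  (ciInf_le (finite_range _).bddBelow 1).trans <| Finset.sum_le_sum fun i _ =>
    mul_le_mul_of_nonneg_left ((le_abs_self _).trans (norm_le_pi_norm y i)) (by positivity)

lemma IsSolution.aemeasurable_mul_sub (ha : IsCoefficients a) (hx : IsSolution a x)
    (i j : Fin n) :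
    AEMeasurable (fun t => a i j t * (x t j - x t i)) (volume.restrict (Ici 0)) :=
  (ha.aemeasurable i j).mul
    (((hx.continuousOn j).sub (hx.continuousOn i)).aemeasurable measurableSet_Ici)

lemma IsSolution.aemeasurable_mul_abs_sub (ha : IsCoefficients a) (hx : IsSolution a x)
    (i j : Fin n) :
    AEMeasurable (fun t => a i j t * |x t j - x t i|) (volume.restrict (Ici 0)) :=
  (ha.aemeasurable i j).mul
    (((hx.continuousOn j).sub (hx.continuousOn i)).abs.aemeasurable measurableSet_Ici)

lemma IsSolution.integrableOn_interaction (ha : IsCoefficients a) (hcb : CutBalanced a)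
    (hx : IsSolution a x) : IntegrableOn (fun t => interaction (a · · t) (x t)) (Ici 0) := by
  obtain ⟨K, hK, hcut⟩ := hcb.exists_isCutBounded
  have hK₀ : 0 ≤ K := by linarith
  have hscaled : IntegrableOn
      (fun t => (2 * (1 + K))⁻¹ * interaction (a · · t) (x t)) (Ici 0) := by
    refine integrableOn_Ici_of_iInf_le
      (f := fun (σ : Equiv.Perm (Fin n)) t => ∑ i, (2 * K) ^ (σ i : ℕ) * x t i)
      (B := ∑ i : Fin n, (2 * K) ^ (i : ℕ) * ‖x 0‖) (fun t ht σ => ?_) (fun t ht => ?_) ?_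
      (fun t ht => ?_) ?_
    · exact absolutelyContinuousOnInterval_sum _ fun i _ =>
        (hx.absolutelyContinuousOnInterval i le_rfl ht).const_mul _
    · refine (lyapunov_le_norm hK₀ (x t)).trans ?_
      gcongr
      exact hx.norm_le_norm ha le_rfl ht
    · exact (Finset.aemeasurable_fun_sum _ fun i _ => Finset.aemeasurable_fun_sum _ fun j _ =>
        hx.aemeasurable_mul_abs_sub ha i j).const_mul _
    · exact mul_nonneg (by positivity) (interaction_nonneg (fun i j => ha.nonneg i j t ht) _)
    · filter_upwards [hx.ae_hasDerivAt, ae_restrict_mem measurableSet_Ici] with u hderiv hu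
      obtain ⟨σ, hσ, hle⟩ :=
        (hcut u hu).exists_perm_interaction_le (fun i j => ha.nonneg i j u hu) hK (x u)
      refine ⟨σ, hσ, ?_⟩
      rwa [(HasDerivAt.fun_sum fun i _ => (hderiv i).const_mul _).deriv]
  rwa [IntegrableOn, integrable_const_mul_iff (isUnit_iff_ne_zero.2 (by positivity))] at hscaled

lemma IsSolution.integrableOn_mul_abs_sub (ha : IsCoefficients a) (hcb : CutBalanced a)
    (hx : IsSolution a x) (i j : Fin n) :
    IntegrableOn (fun t => a i j t * |x t j - x t i|) (Ici 0) := by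
  refine (hx.integrableOn_interaction ha hcb).mono'
    (hx.aemeasurable_mul_abs_sub ha i j).aestronglyMeasurable ?_
  filter_upwards [ae_restrict_mem measurableSet_Ici] with t ht
  rw [Real.norm_of_nonneg (mul_nonneg (ha.nonneg i j t ht) (abs_nonneg _))]
  exact mul_abs_sub_le_interaction (fun i j => ha.nonneg i j t ht) (x t) i j

lemma IsSolution.integrableOn_mul_sub (ha : IsCoefficients a) (hcb : CutBalanced a)
    (hx : IsSolution a x) (i j : Fin n) :
    IntegrableOn (fun t => a i j t * (x t j - x t i)) (Ici 0) :=
  Integrable.mono (hx.integrableOn_mul_abs_sub ha hcb i j)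
    (hx.aemeasurable_mul_sub ha i j).aestronglyMeasurable (Eventually.of_forall fun t => by simp)

lemma IsSolution.exists_tendsto (ha : IsCoefficients a) (hcb : CutBalanced a)
    (hx : IsSolution a x) (i : Fin n) : ∃ l, Tendsto (fun t => x t i) atTop (𝓝 l) := by
  have hdrift : IntegrableOn (fun t => drift (a · · t) (x t) i) (Ioi 0) :=
    (integrableOn_Ici_iff_integrableOn_Ioi ..).1
      (integrable_finsetSum _ fun j _ => hx.integrableOn_mul_sub ha hcb i j)
  refine ⟨x 0 i + ∫ u in Ioi 0, drift (a · · u) (x u) i,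
    ((intervalIntegral_tendsto_integral_Ioi 0 hdrift tendsto_id).const_add (x 0 i)).congr' ?_⟩
  filter_upwards [eventually_ge_atTop 0] with t ht
  exact (hx.eq_add_integral i le_rfl ht).symm

lemma IsSolution.exists_tendsto_mem_Icc (ha : IsCoefficients a) (hcb : CutBalanced a)
    (hx : IsSolution a x) (i : Fin n) :
    ∃ l ∈ Icc (⨅ j, x 0 j) (⨆ j, x 0 j), Tendsto (fun t => x t i) atTop (𝓝 l) := by
  obtain ⟨l, hl⟩ := hx.exists_tendsto ha hcb i
  refine ⟨l, ⟨ge_of_tendsto hl ?_, le_of_tendsto hl ?_⟩, hl⟩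
  · filter_upwards [eventually_ge_atTop 0] with t ht
    exact hx.ge_of_ge ha le_rfl ht (fun j => ciInf_le (finite_range _).bddBelow j) i
  · filter_upwards [eventually_ge_atTop 0] with t ht
    exact hx.le_of_le ha le_rfl ht (fun j => le_ciSup (finite_range _).bddAbove j) i

end Convergence

section WeakComponents

variable {V : Type*} {G : Digraph V} {u v : V}

lemma weakComponent_eq_of_adj (h : G.Adj u v) : weakComponent G u = weakComponent G v := by
  rcases eq_or_ne u v with rfl | huv
  · rfl
  · exact SimpleGraph.ConnectedComponent.sound (SimpleGraph.Adj.reachable ⟨huv, Or.inl h⟩)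

lemma eq_of_weakComponent_eq {α : Type*} {f : V → α} (hf : ∀ u v, G.Adj u v → f u = f v)
    (huv : weakComponent G u = weakComponent G v) : f u = f v := by
  have hreach := SimpleGraph.ConnectedComponent.exact huv
  rw [SimpleGraph.reachable_iff_reflTransGen] at hreach
  induction hreach with
  | refl => rfl
  | tail hreach hadj ih =>
    refine (ih (SimpleGraph.ConnectedComponent.sound
      ((SimpleGraph.reachable_iff_reflTransGen _ _).2 hreach))).trans ?_
    exact hadj.2.elim (hf _ _) fun h => (hf _ _ h).symm

lemma reflTransGen_of_weakComponent_eq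
    (hG : ∀ u v, G.Adj u v → Relation.ReflTransGen G.Adj v u)
    (huv : weakComponent G u = weakComponent G v) : Relation.ReflTransGen G.Adj u v := by
  have hreach := eq_of_weakComponent_eq (f := fun u => {w | Relation.ReflTransGen G.Adj u w})
    (fun u v h => Set.ext fun w => ⟨(hG u v h).trans, .head h⟩) huv
  change v ∈ {w | Relation.ReflTransGen G.Adj u w}
  rw [hreach]
  exact .refl

lemma stronglyConnectedOn_supp
    (hG : ∀ u v, G.Adj u v → Relation.ReflTransGen G.Adj v u) (C : WeakComponent G) :
    StronglyConnectedOn G C.supp := by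
  rintro ⟨u, rfl⟩ ⟨v, hv⟩
  have lift : ∀ {w}, Relation.ReflTransGen G.Adj u w → ∀ hw : w ∈ (weakComponent G u).supp,
      Relation.ReflTransGen (fun p q : (weakComponent G u).supp => G.Adj p q)
        ⟨u, rfl⟩ ⟨w, hw⟩ := by
    intro w huw
    induction huw with
    | refl => exact fun _ => .refl
    | tail _ hadj ih => exact fun hw => (ih ((weakComponent_eq_of_adj hadj).trans hw)).tail hadj
  exact lift (reflTransGen_of_weakComponent_eq hG hv.symm) hv

lemma reflTransGen_symm_of_forall_not_adj
    (hG : ∀ S : Set V, (∀ u ∈ S, ∀ v ∉ S, ¬ G.Adj u v) → ∀ u ∉ S, ∀ v ∈ S, ¬ G.Adj u v)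
    (huv : G.Adj u v) : Relation.ReflTransGen G.Adj v u := by
  by_contra hvu
  exact hG {w | Relation.ReflTransGen G.Adj v w} (fun p hp q hq hpq => hq (hp.tail hpq)) u hvu v
    .refl huv

end WeakComponents

section UnboundedGraph

variable {n : ℕ} {a : Fin n → Fin n → ℝ → ℝ} {x : ℝ → Fin n → ℝ}

lemma IsCoefficients.integrableOn_iff (ha : IsCoefficients a) (i j : Fin n) {A : Set ℝ}
    (hA : MeasurableSet A) (hA₀ : A ⊆ Ici 0) :
    IntegrableOn (a i j) A ↔ ∫⁻ t in A, ENNReal.ofReal (a i j t) < ⊤ := by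
  have hnonneg : 0 ≤ᵐ[volume.restrict A] a i j := by
    filter_upwards [ae_restrict_mem hA] with t ht using ha.nonneg i j t (hA₀ ht)
  rw [IntegrableOn, Integrable, hasFiniteIntegral_iff_ofReal hnonneg]
  exact and_iff_right ((ha.aemeasurable i j).mono_set hA₀).aestronglyMeasurable

lemma unboundedGraph_adj_iff (ha : IsCoefficients a) {i j : Fin n} :
    (unboundedGraph a).Adj j i ↔ ¬ IntegrableOn (a i j) (Ici 0) := by
  rw [ha.integrableOn_iff i j measurableSet_Ici Subset.rfl, not_lt_top_iff]
  rfl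

lemma LocallyBounded.locallyIntegrableOn (ha : IsCoefficients a) (hlb : LocallyBounded a)
    (i j : Fin n) : LocallyIntegrableOn (a i j) (Ici 0) := by
  refine (locallyIntegrableOn_iff isClosed_Ici.isLocallyClosed).2 fun A hA hcompact => ?_
  obtain ⟨T, hT⟩ := hcompact.bddAbove
  exact ((ha.integrableOn_iff i j measurableSet_Icc Icc_subset_Ici_self).2 (hlb i j T)).mono_set
    fun t ht => ⟨hA ht, hT ht⟩

lemma CutBalanced.not_adj_of_forall_not_adj (ha : IsCoefficients a) (hcb : CutBalanced a)
    {S : Set (Fin n)} (hS : ∀ u ∈ S, ∀ v ∉ S, ¬ (unboundedGraph a).Adj u v) {u v : Fin n}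
    (hu : u ∉ S) (hv : v ∈ S) : ¬ (unboundedGraph a).Adj u v := by
  classical
  obtain ⟨K, -, hcut⟩ := hcb.exists_isCutBounded
  set C : Finset (Fin n) := Finset.univ.filter (· ∉ S)
  simp only [unboundedGraph_adj_iff ha, not_not] at hS ⊢
  have hout : IntegrableOn (fun t => K * ∑ i ∈ C, ∑ j ∈ Cᶜ, a i j t) (Ici 0) :=
    (integrable_finsetSum _ fun i hi => integrable_finsetSum _ fun j hj =>
      hS j (by simpa [C] using hj) i (by simpa [C] using hi)).const_mul K
  refine hout.mono' (ha.aemeasurable v u).aestronglyMeasurable ?_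
  filter_upwards [ae_restrict_mem measurableSet_Ici] with t ht
  have hnonneg : ∀ i j, 0 ≤ a i j t := fun i j => ha.nonneg i j t ht
  calc ‖a v u t‖ = a v u t := Real.norm_of_nonneg (hnonneg v u)
    _ ≤ ∑ j ∈ C, a v j t := Finset.single_le_sum (f := fun j => a v j t)
        (fun j _ => hnonneg v j) (by simpa [C] using hu)
    _ ≤ ∑ i ∈ Cᶜ, ∑ j ∈ C, a i j t := Finset.single_le_sum (f := fun i => ∑ j ∈ C, a i j t)
        (fun i _ => Finset.sum_nonneg fun j _ => hnonneg i j) (by simpa [C] using hv)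
    _ ≤ K * ∑ i ∈ C, ∑ j ∈ Cᶜ, a i j t := hcut t ht C

lemma CutBalanced.stronglyConnectedOn_supp (ha : IsCoefficients a) (hcb : CutBalanced a)
    (C : WeakComponent (unboundedGraph a)) : StronglyConnectedOn (unboundedGraph a) C.supp :=
  Consensus.stronglyConnectedOn_supp (fun _ _ => reflTransGen_symm_of_forall_not_adj
    fun _ hS _ hu _ hv => hcb.not_adj_of_forall_not_adj ha hS hu hv) C

lemma eq_zero_of_tendsto_of_integrableOn_mul {f g : ℝ → ℝ} {s l : ℝ}
    (hf : LocallyIntegrableOn f (Ici s)) (hf' : ¬ IntegrableOn f (Ici s))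
    (hfg : IntegrableOn (fun t => f t * g t) (Ici s)) (hg : Tendsto g atTop (𝓝 l)) : l = 0 := by
  by_contra hl
  have hcancel : (fun t => f t * g t * (g t)⁻¹) =ᶠ[atTop] f := by
    filter_upwards [hg.eventually_ne hl] with t ht using mul_inv_cancel_right₀ ht _
  have hbound : f =O[atTop] fun t => f t * g t := by
    simpa using hcancel.symm.trans_isBigO
      ((Asymptotics.isBigO_refl (fun t => f t * g t) atTop).mul ((hg.inv₀ hl).isBigO_one ℝ))
  exact hf' (hf.integrableOn_of_isBigO_atTop hbound ⟨Ici s, Ici_mem_atTop s, hfg⟩)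

lemma IsSolution.limit_eq_of_adj (ha : IsCoefficients a) (hcb : CutBalanced a)
    (hlb : LocallyBounded a) (hx : IsSolution a x) {i j : Fin n}
    (hij : (unboundedGraph a).Adj i j) {li lj : ℝ} (hi : Tendsto (fun t => x t i) atTop (𝓝 li))
    (hj : Tendsto (fun t => x t j) atTop (𝓝 lj)) : li = lj :=
  sub_eq_zero.1 (eq_zero_of_tendsto_of_integrableOn_mul (hlb.locallyIntegrableOn ha j i)
    ((unboundedGraph_adj_iff ha).1 hij) (hx.integrableOn_mul_sub ha hcb j i) (hi.sub hj))

lemma IsSolution.limit_eq_of_weakComponent_eq (ha : IsCoefficients a) (hcb : CutBalanced a)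
    (hlb : LocallyBounded a) (hx : IsSolution a x) {i j : Fin n}
    (hij : weakComponent (unboundedGraph a) i = weakComponent (unboundedGraph a) j)
    {li lj : ℝ} (hi : Tendsto (fun t => x t i) atTop (𝓝 li))
    (hj : Tendsto (fun t => x t j) atTop (𝓝 lj)) : li = lj := by
  choose l hl using hx.exists_tendsto ha hcb
  rw [tendsto_nhds_unique hi (hl i), tendsto_nhds_unique hj (hl j)]
  exact eq_of_weakComponent_eq (fun u v h => hx.limit_eq_of_adj ha hcb hlb h (hl u) (hl v)) hij

end UnboundedGraph

section BackwardUniqueness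

variable {n : ℕ} {a : Fin n → Fin n → ℝ → ℝ} {x : ℝ → Fin n → ℝ} {s t : ℝ}

lemma LocallyBounded.integrableOn_sum (ha : IsCoefficients a) (hlb : LocallyBounded a)
    (hs : 0 ≤ s) : IntegrableOn (fun u => ∑ k, ∑ l, a k l u) (Icc s t) :=
  integrable_finsetSum _ fun k _ => integrable_finsetSum _ fun l _ =>
    (hlb.locallyIntegrableOn ha k l).integrableOn_compact_subset
      (Icc_subset_Ici_self.trans (Ici_subset_Ici.2 hs)) isCompact_Icc

lemma IsSolution.norm_sub_le (ha : IsCoefficients a) (hlb : LocallyBounded a)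
    (hx : IsSolution a x) (hs : 0 ≤ s) (hst : s ≤ t) :
    ‖x t - x s‖ ≤ (∫ u in s..t, ∑ k, ∑ l, a k l u) * (2 * ‖x s‖) := by
  have hint := (intervalIntegrable_iff_integrableOn_Icc_of_le hst).2
    (hlb.integrableOn_sum ha hs (t := t))
  have hnonneg : ∀ u ∈ Icc s t, ∀ k l, 0 ≤ a k l u := fun u hu k l =>
    ha.nonneg k l u (hs.trans hu.1)
  refine (pi_norm_le_iff_of_nonneg (mul_nonneg (intervalIntegral.integral_nonneg hst fun u hu =>
    Finset.sum_nonneg fun k _ => Finset.sum_nonneg fun l _ => hnonneg u hu k l)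
      (by positivity))).2 fun i => ?_
  have hdrift := hx.intervalIntegrable_drift i hs (hs.trans hst)
  calc ‖x t i - x s i‖ = |∫ u in s..t, drift (a · · u) (x u) i| := by
        rw [hx.eq_add_integral i hs (hs.trans hst), add_sub_cancel_left, Real.norm_eq_abs]
    _ ≤ ∫ u in s..t, |drift (a · · u) (x u) i| :=
        intervalIntegral.abs_integral_le_integral_abs hst
    _ ≤ ∫ u in s..t, (∑ k, ∑ l, a k l u) * (2 * ‖x s‖) := by
        refine intervalIntegral.integral_mono_on hst hdrift.abs (hint.mul_const _) fun u hu => ?_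
        refine (abs_drift_le (hnonneg u hu) (x u) i).trans ?_
        gcongr
        · exact Finset.sum_nonneg fun k _ => Finset.sum_nonneg fun l _ => hnonneg u hu k l
        · exact hx.norm_le_norm ha hs hu.1
    _ = (∫ u in s..t, ∑ k, ∑ l, a k l u) * (2 * ‖x s‖) :=
        intervalIntegral.integral_mul_const ..

lemma IsSolution.eventually_eq_zero_nhdsLT (ha : IsCoefficients a) (hlb : LocallyBounded a)
    (hx : IsSolution a x) (ht : 0 < t) (hxt : x t = 0) : ∀ᶠ s in 𝓝[<] t, x s = 0 := by
  have hcont : ContinuousOn (fun s => ∫ u in s..t, ∑ k, ∑ l, a k l u) (Icc 0 t) := by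
    rw [← uIcc_of_le ht.le]
    exact intervalIntegral.continuousOn_primitive_interval_left
      (uIcc_of_le ht.le ▸ hlb.integrableOn_sum ha le_rfl)
  have hsmall : ∀ᶠ s in 𝓝[<] t, ∫ u in s..t, ∑ k, ∑ l, a k l u < 1 / 2 := by
    refine ((hcont t ⟨ht.le, le_rfl⟩).eventually_lt_const ?_).filter_mono
      (nhdsWithin_le_of_mem (Icc_mem_nhdsLT ht))
    norm_num
  filter_upwards [hsmall, Ioo_mem_nhdsLT ht] with s hs hst
  have hle := hx.norm_sub_le ha hlb hst.1.le hst.2.le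
  rw [hxt, zero_sub, norm_neg] at hle
  by_contra hne
  nlinarith [norm_pos_iff.2 hne]

lemma IsSolution.initial_eq_zero (ha : IsCoefficients a) (hlb : LocallyBounded a)
    (hx : IsSolution a x) (ht : 0 ≤ t) (hxt : x t = 0) : x 0 = 0 := by
  have hcompact : IsCompact (Icc 0 t ∩ x ⁻¹' {0}) :=
    isCompact_Icc.of_isClosed_subset ((continuousOn_pi.2 fun i =>
      (hx.continuousOn i).mono Icc_subset_Ici_self).preimage_isClosed_of_isClosed isClosed_Icc
        isClosed_singleton) inter_subset_left
  obtain ⟨s, ⟨⟨hs, hst⟩, hxs : x s = 0⟩, hleast⟩ :=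
    hcompact.exists_isLeast ⟨t, ⟨ht, le_rfl⟩, hxt⟩
  rcases hs.eq_or_lt with rfl | hpos
  · exact hxs
  obtain ⟨r, hr, hrs⟩ :=
    ((hx.eventually_eq_zero_nhdsLT ha hlb hpos hxs).and (Ioo_mem_nhdsLT hpos)).exists
  exact absurd (hleast ⟨⟨hrs.1.le, hrs.2.le.trans hst⟩, hr⟩) hrs.2.not_ge

end BackwardUniqueness

section Separation

variable {n : ℕ} {a : Fin n → Fin n → ℝ → ℝ} {x : ℝ → Fin n → ℝ} {i j : Fin n}

open Classical in
/-- The total rate of the interactions between agents of different components of the unbounded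
interactions graph. -/
noncomputable def crossInteraction (a : Fin n → Fin n → ℝ → ℝ) (t : ℝ) : ℝ :=
  ∑ k, ∑ l, if weakComponent (unboundedGraph a) k = weakComponent (unboundedGraph a) l then 0
    else a k l t

lemma integrableOn_crossInteraction (ha : IsCoefficients a) :
    IntegrableOn (crossInteraction a) (Ici 0) := by
  refine integrable_finsetSum _ fun k _ => integrable_finsetSum _ fun l _ => ?_
  split_ifs with h
  · exact integrable_zero _ _ _
  · by_contra hnot
    exact h (weakComponent_eq_of_adj ((unboundedGraph_adj_iff ha).2 hnot)).symm

lemma sum_compl_le_crossInteraction (ha : IsCoefficients a) {C : Finset (Fin n)}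
    (hC : ∀ k ∈ C, ∀ l ∉ C,
      weakComponent (unboundedGraph a) k ≠ weakComponent (unboundedGraph a) l)
    {t : ℝ} (ht : 0 ≤ t) {k : Fin n} (hk : k ∈ C) :
    ∑ l ∈ Cᶜ, a k l t ≤ crossInteraction a t := by
  classical
  set c : Fin n → Fin n → ℝ := fun k l =>
    if weakComponent (unboundedGraph a) k = weakComponent (unboundedGraph a) l then 0 else a k l t
  have hc : ∀ k l, 0 ≤ c k l := fun k l => by
    dsimp only [c]
    split_ifs
    exacts [le_rfl, ha.nonneg k l t ht]
  calc ∑ l ∈ Cᶜ, a k l t = ∑ l ∈ Cᶜ, c k l :=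
        Finset.sum_congr rfl fun l hl => (if_neg (hC k hk l (Finset.mem_compl.1 hl))).symm
    _ ≤ ∑ l, c k l :=
        Finset.sum_le_sum_of_subset_of_nonneg (Finset.subset_univ _) fun l _ _ => hc k l
    _ ≤ ∑ k, ∑ l, c k l := Finset.single_le_sum (f := fun k => ∑ l, c k l)
        (fun k _ => Finset.sum_nonneg fun l _ => hc k l) (Finset.mem_univ k)
    _ = crossInteraction a t := by simp only [crossInteraction, c]

lemma exists_forall_integral_le {f : ℝ → ℝ} {s ε : ℝ} (hf : IntegrableOn f (Ici s))
    (hε : 0 < ε) : ∃ T, s ≤ T ∧ ∀ t, T ≤ t → ∫ u in T..t, f u ≤ ε := by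
  have hint : ∀ t, s ≤ t → IntervalIntegrable f volume s t := fun t ht =>
    (intervalIntegrable_iff_integrableOn_Icc_of_le ht).2 (hf.mono_set Icc_subset_Ici_self)
  obtain ⟨N, hN⟩ := Metric.cauchySeq_iff.1 (intervalIntegral_tendsto_integral_Ioi s
    (hf.mono_set Ioi_subset_Ici_self) tendsto_id).cauchySeq ε hε
  refine ⟨max s N, le_max_left .., fun t ht => ?_⟩
  have hdist := hN t ((le_max_right ..).trans ht) (max s N) (le_max_right ..)
  rw [← intervalIntegral.integral_interval_sub_left (hint t ((le_max_left ..).trans ht))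
    (hint _ (le_max_left ..))]
  exact (le_abs_self _).trans hdist.le

lemma IsSolution.one_sub_integral_crossInteraction_le (ha : IsCoefficients a)
    (hx : IsSolution a x) {C : Finset (Fin n)}
    (hC : ∀ k ∈ C, ∀ l ∉ C,
      weakComponent (unboundedGraph a) k ≠ weakComponent (unboundedGraph a) l)
    {T t : ℝ} (hT : 0 ≤ T) (hTt : T ≤ t) (hx₀ : ∀ k, 0 ≤ x T k) (hx₁ : ∀ k, x T k ≤ 1)
    (hxC : ∀ k ∈ C, x T k = 1) {k : Fin n} (hk : k ∈ C) :
    1 - ∫ u in T..t, crossInteraction a u ≤ x t k := by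
  have hint : IntervalIntegrable (crossInteraction a) volume T t :=
    (intervalIntegrable_iff_integrableOn_Icc_of_le hTt).2 ((integrableOn_crossInteraction
      ha).mono_set (Icc_subset_Ici_self.trans (Ici_subset_Ici.2 hT)))
  rw [sub_eq_add_neg, ← intervalIntegral.integral_neg]
  refine hx.add_integral_le hT hTt (C := C) hint.neg (fun l hl => (hxC l hl).ge)
    (fun u hu l hl hmin => ?_) hk
  refine (neg_le_neg (sum_compl_le_crossInteraction ha hC (hT.trans hu) hl)).trans ?_
  refine neg_sum_compl_le_drift (fun i j => ha.nonneg i j u (hT.trans hu)) hmin fun j => ?_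
  linarith [hx.ge_of_ge ha hT hu hx₀ j, hx.le_of_le ha hT hu hx₁ l]

lemma IsSolution.one_third_le_sub (ha : IsCoefficients a) (hx : IsSolution a x)
    {C : Finset (Fin n)}
    (hC : ∀ k ∈ C, ∀ l ∉ C,
      weakComponent (unboundedGraph a) k ≠ weakComponent (unboundedGraph a) l)
    {T t : ℝ} (hT : 0 ≤ T) (hTt : T ≤ t) (hsmall : ∫ u in T..t, crossInteraction a u ≤ 1 / 3)
    (hxC : ∀ k ∈ C, x T k = 1) (hxC' : ∀ k ∉ C, x T k = 0) (hi : i ∈ C) (hj : j ∉ C) :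
    1 / 3 ≤ x t i - x t j := by
  have hmem : ∀ k, x T k ∈ Icc 0 1 := fun k => by
    by_cases hk : k ∈ C
    · simp [hxC k hk]
    · simp [hxC' k hk]
  have hup := hx.one_sub_integral_crossInteraction_le ha hC hT hTt (fun k => (hmem k).1)
    (fun k => (hmem k).2) hxC hi
  have hdown := ((isSolution_const a 1).add
    (hx.const_smul (-1))).one_sub_integral_crossInteraction_le (C := Cᶜ) ha
      (fun k hk l hl => (hC l (by simpa using hl) k (by simpa using hk)).symm) hT hTt
      (fun k => by simpa using (hmem k).2) (fun k => by simpa using (hmem k).1)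
      (fun k hk => by simpa using hxC' k (by simpa using hk)) (k := j) (by simpa using hj)
  simp only [Pi.add_apply, Pi.smul_apply, smul_eq_mul] at hdown
  linarith

lemma exists_forall_not_tendsto_sub (ha : IsCoefficients a)
    (hij : weakComponent (unboundedGraph a) i ≠ weakComponent (unboundedGraph a) j) :
    ∃ T, 0 ≤ T ∧ ∃ v : Fin n → ℝ, ∀ x, IsSolution a x → x T = v →
      ¬ Tendsto (fun t => x t i - x t j) atTop (𝓝 0) := by
  classical
  obtain ⟨T, hT, htail⟩ := exists_forall_integral_le (integrableOn_crossInteraction ha)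
    (by norm_num : (0 : ℝ) < 1 / 3)
  set C := Finset.univ.filter fun k =>
    weakComponent (unboundedGraph a) k = weakComponent (unboundedGraph a) i
  refine ⟨T, hT, fun k => if k ∈ C then 1 else 0, fun x hx hxT hlim => ?_⟩
  have hgap : ∀ t, T ≤ t → 1 / 3 ≤ x t i - x t j := fun t ht => by
    refine hx.one_third_le_sub ha (C := C) (fun k hk l hl hkl => ?_) hT ht (htail t ht)
      (fun k hk => by simp [hxT, hk]) (fun k hk => by simp [hxT, hk]) (by simp [C])
      (by simpa [C] using hij.symm)
    simp only [C, Finset.mem_filter_univ] at hk hl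
    exact hl (hkl.symm.trans hk)
  linarith [ge_of_tendsto hlim ((eventually_ge_atTop T).mono hgap)]

end Separation

section Hyperplane

variable {n : ℕ} {a : Fin n → Fin n → ℝ → ℝ} {i j : Fin n}

lemma surjective_of_ker_le_ker {k M V : Type*} [Field k] [AddCommGroup M] [Module k M]
    [AddCommGroup V] [Module k V] [FiniteDimensional k V] {f g : M →ₗ[k] V}
    (hf : Function.Surjective f) (hfg : LinearMap.ker g ≤ LinearMap.ker f) :
    Function.Surjective g := by
  obtain ⟨s, hs⟩ := f.exists_rightInverse_of_surjective (LinearMap.range_eq_top.2 hf)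
  have hinj : Function.Injective (g ∘ₗ s) := (injective_iff_map_eq_zero _).2 fun v hv =>
    (LinearMap.congr_fun hs v).symm.trans (hfg hv)
  exact .of_comp (LinearMap.injective_iff_surjective.1 hinj)

lemma exists_hyperplane_ge {k V : Type*} [Field k] [AddCommGroup V] [Module k V]
    [FiniteDimensional k V] {W : Submodule k V} (hW : W ≠ ⊤) :
    ∃ H : Submodule k V, Module.finrank k H + 1 = Module.finrank k V ∧ W ≤ H := by
  obtain ⟨f, hf, hWf⟩ := W.exists_le_ker_of_lt_top hW.lt_top
  exact ⟨LinearMap.ker f, Module.Dual.finrank_ker_add_one_of_ne_zero hf, hWf⟩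

/-- The solutions whose components `i` and `j` approach each other. Their initial values form the
exceptional subspace of the theorem, up to enlarging it to a hyperplane. -/
def equalLimitSolutions (a : Fin n → Fin n → ℝ → ℝ) (i j : Fin n) :
    Submodule ℝ (ℝ → Fin n → ℝ) where
  carrier := {x | IsSolution a x ∧ Tendsto (fun t => x t i - x t j) atTop (𝓝 0)}
  zero_mem' := ⟨isSolution_const a 0, by simp⟩
  add_mem' hx hy := ⟨hx.1.add hy.1, by
    simpa [add_sub_add_comm] using hx.2.add hy.2⟩
  smul_mem' r x hx := ⟨hx.1.const_smul r, by simpa [mul_sub] using hx.2.const_mul r⟩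

/-- Evaluation at time `t` on the solutions whose components `i` and `j` approach each other. -/
def equalLimitEval (a : Fin n → Fin n → ℝ → ℝ) (i j : Fin n) (t : ℝ) :
    equalLimitSolutions a i j →ₗ[ℝ] (Fin n → ℝ) :=
  LinearMap.proj t ∘ₗ (equalLimitSolutions a i j).subtype

lemma range_equalLimitEval_zero_ne_top (ha : IsCoefficients a) (hlb : LocallyBounded a)
    (hij : weakComponent (unboundedGraph a) i ≠ weakComponent (unboundedGraph a) j) :
    LinearMap.range (equalLimitEval a i j 0) ≠ ⊤ := by
  intro htop
  obtain ⟨T, hT, v, hv⟩ := exists_forall_not_tendsto_sub ha hij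
  have hker : LinearMap.ker (equalLimitEval a i j T) ≤ LinearMap.ker (equalLimitEval a i j 0) :=
    fun x hxT => x.2.1.initial_eq_zero ha hlb hT hxT
  obtain ⟨⟨x, hx, hlim⟩, hxT⟩ := surjective_of_ker_le_ker (LinearMap.range_eq_top.1 htop) hker v
  exact hv x hx hxT hlim

lemma exists_hyperplane_forall_not_tendsto_sub (ha : IsCoefficients a) (hlb : LocallyBounded a)
    (hij : weakComponent (unboundedGraph a) i ≠ weakComponent (unboundedGraph a) j) :
    ∃ V : Submodule ℝ (Fin n → ℝ), Module.finrank ℝ V + 1 = n ∧ ∀ x, IsSolution a x →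
      x 0 ∉ V → ¬ Tendsto (fun t => x t i - x t j) atTop (𝓝 0) := by
  obtain ⟨V, hV, hle⟩ := exists_hyperplane_ge (range_equalLimitEval_zero_ne_top ha hlb hij)
  exact ⟨V, by simpa using hV, fun x hx h₀ hlim => h₀ (hle ⟨⟨x, hx, hlim⟩, rfl⟩)⟩

end Hyperplane

end Consensus

theorem theorem1_general {n : ℕ} (a : Fin n → Fin n → ℝ → ℝ) (ha : Consensus.IsCoefficients a) :
    (Consensus.CutBalanced a →
      (∀ x, Consensus.IsSolution a x →
        ∀ i, ∃ l ∈ Icc (⨅ j, x 0 j) (⨆ j, x 0 j), Tendsto (fun t => x t i) atTop (𝓝 l)) ∧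
      (∀ C : Consensus.WeakComponent (Consensus.unboundedGraph a),
        Consensus.StronglyConnectedOn (Consensus.unboundedGraph a) C.supp) ∧
      ∀ x, Consensus.IsSolution a x →
        (∀ i j, IntegrableOn (fun t => a i j t * |x t j - x t i|) (Ici 0)) ∧
        (Consensus.LocallyBounded a →
          ∀ i j, Consensus.weakComponent (Consensus.unboundedGraph a) i =
              Consensus.weakComponent (Consensus.unboundedGraph a) j →
            ∀ li lj : ℝ, Tendsto (fun t => x t i) atTop (𝓝 li) →
              Tendsto (fun t => x t j) atTop (𝓝 lj) → li = lj)) ∧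
    (Consensus.LocallyBounded a →
      ∀ i j, Consensus.weakComponent (Consensus.unboundedGraph a) i ≠
          Consensus.weakComponent (Consensus.unboundedGraph a) j →
        ∃ V : Submodule ℝ (Fin n → ℝ), Module.finrank ℝ V + 1 = n ∧
          ∀ x, Consensus.IsSolution a x → x 0 ∉ V →
            ¬ Tendsto (fun t => x t i - x t j) atTop (𝓝 0)) :=
  ⟨fun hcb => ⟨fun _ hx => hx.exists_tendsto_mem_Icc ha hcb, hcb.stronglyConnectedOn_supp ha,
    fun _ hx => ⟨hx.integrableOn_mul_abs_sub ha hcb, fun hlb _ _ hij _ _ =>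
      hx.limit_eq_of_weakComponent_eq ha hcb hlb hij⟩⟩,
    fun hlb _ _ => Consensus.exists_hyperplane_forall_not_tendsto_sub ha hlb⟩

theorem theorem1 {n : ℕ} (a : Fin n → Fin n → ℝ → ℝ)
    (ha : Consensus.IsCoefficients a) (hcb : Consensus.CutBalanced a) :
    -- (a)
    (∀ x : ℝ → Fin n → ℝ, Consensus.IsSolution a x →
      ∀ i, ∃ l ∈ Icc (⨅ j, x 0 j) (⨆ j, x 0 j), Tendsto (fun t => x t i) atTop (𝓝 l)) ∧
    -- (b)
    (∀ C : Consensus.WeakComponent (Consensus.unboundedGraph a),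
      Consensus.StronglyConnectedOn (Consensus.unboundedGraph a) C.supp) ∧
    (Consensus.LocallyBounded a →
      -- (c)
      (∀ x : ℝ → Fin n → ℝ, Consensus.IsSolution a x →
        (∀ i j, IntegrableOn (fun t => a i j t * |x t j - x t i|) (Ici 0)) ∧
        ∀ i j, Consensus.weakComponent (Consensus.unboundedGraph a) i =
            Consensus.weakComponent (Consensus.unboundedGraph a) j →
          ∀ li lj : ℝ, Tendsto (fun t => x t i) atTop (𝓝 li) →
            Tendsto (fun t => x t j) atTop (𝓝 lj) → li = lj) ∧
      -- (d)
      (∀ i j, Consensus.weakComponent (Consensus.unboundedGraph a) i ≠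
          Consensus.weakComponent (Consensus.unboundedGraph a) j →
        ∃ V : Submodule ℝ (Fin n → ℝ), Module.finrank ℝ V + 1 = n ∧
          ∀ x : ℝ → Fin n → ℝ, Consensus.IsSolution a x → x 0 ∉ V →
            ∀ li lj : ℝ, Tendsto (fun t => x t i) atTop (𝓝 li) →
              Tendsto (fun t => x t j) atTop (𝓝 lj) → li ≠ lj)) := by
  obtain ⟨hcut, hsep⟩ := theorem1_general a ha
  obtain ⟨hlim, hconn, hint⟩ := hcut hcb
  refine ⟨hlim, hconn, fun hlb => ⟨fun x hx => (hint x hx).imp_right (· hlb), fun i j hij => ?_⟩⟩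
  obtain ⟨V, hV, hnot⟩ := hsep hlb i j hij
  exact ⟨V, hV, fun x hx h₀ li lj hi hj h => hnot x hx h₀ (by simpa [h] using hi.sub hj)⟩
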